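/- An ideal on a countably infinite set $X$ is a family $\mathcal I\subseteq\mathcal P(X)$ that is closed under finite unions and subsets, contains all finite subsets of $X$, and satisfies $X\notin\mathcal I$. Ideals $\mathcal I$ on $X$ and $\mathcal J$ on $Y$ are isomorphic if there is a bijection $f:Y\to X$ with $A\in\mathcal I\Leftrightarrow f^{-1}[A]\in\mathcal J$ for all $A\subseteq X$. $\mathcal I$ is countably generated if there is a countable $\mathcal G\subseteq\mathcal I$ such that each member of $\mathcal I$ is covered by finitely many members of $\mathcal G$. Put $\omega=\{0,1,2,\dots\}$, let $\mathrm{Fin}$ be the ideal of finite subsets of $\omega$, and define $$\mathrm{Fin}\oplus\mathcal P(\omega)=\{M\subseteq(\{0\}\times\omega)\cup(\{1\}\times\omega):\{n:(0,n)\in M\}\text{ is finite}\},$$ $$\mathrm{Fin}\otimes\{\emptyset\}=\{M\subseteq\omega\times\omega:\{n:\exists m\ (n,m)\in M\}\text{ is finite}\}.$$ A submeasure on $\omega$ is a function $\varphi:\mathcal P(\omega)\to[0,\infty]$ with $\varphi(\emptyset)=0$, $\varphi(\{n\})<\infty$ for all $n$, and $\varphi(A)\le\varphi(A\cup B)\le\varphi(A)+\varphi(B)$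 for all $A,B\subseteq\omega$. It is non-pathological if, for every $A\subseteq\omega$, $\varphi(A)$ is the supremum of $\mu(A)$ over all (countably additive) measures $\mu$ on $\mathcal P(\omega)$ with $\mu(B)\le\varphi(B)$ for all $B\subseteq\omega$; such a $\varphi$ is automatically lower semicontinuous, i.e. $\varphi(A)=\lim_n\varphi(A\cap\{0,\dots,n-1\})$. A non-pathological $\mathbf\Sigma^0_2$ ideal is an ideal on $\omega$ that is an $F_\sigma$ subset of $\mathcal P(\omega)\cong 2^\omega$ and has the form $\mathrm{Fin}(\varphi)=\{A\subseteq\omega:\varphi(A)<\infty\}$ for some non-pathological submeasure $\varphi$. An ideal $\mathcal I$ on $\omega$ is Egorov if, for all Lebesgue measurable functions $f_n,f:[0,1]\to\mathbb R$ ($n\in\omega$) such that $\{n:f_n(x)\notin U\}\in\mathcal I$ for every $x\in[0,1]$ and every open $U\ni f(x)$, and for every $\eta>0$, there is a Lebesgue measurable $M\subseteq[0,1]$ with $\lambda([0,1]\setminus M)<\eta$ such that $\{n:\exists x\in M\ |f_n(x)-f(x)|\ge\varepsilon\}\in\mathcal I$ for every $\varepsilon>0$. **Theorem.** Let $\mathcal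 I$ be a non-pathological $\mathbf\Sigma^0_2$ ideal. The following are equivalent: (a) $\mathcal I$ is Egorov; (b) $\mathcal I$ is countably generated; (c) $\mathcal I$ is isomorphic to $\mathrm{Fin}$, $\mathrm{Fin}\oplus\mathcal P(\omega)$ or $\mathrm{Fin}\otimes\{\emptyset\}$. Moreover, up to isomorphism there are exactly three non-pathological $\mathbf\Sigma^0_2$ Egorov ideals: every family of subsets of $\omega$ isomorphic (in the sense above) to one of the three ideals in (c) is a non-pathological $\mathbf\Sigma^0_2$ Egorov ideal, and these three ideals are pairwise non-isomorphic. -/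

import Mathlib

open MeasureTheory
open scoped ENNReal

namespace EgorovIdeals

/-- `I` is an ideal on the set `X`: closed under finite unions and subsets, containing all finite
sets, and proper. -/
structure IsIdealOn {X : Type*} (I : Set (Set X)) : Prop where
  union_mem : ∀ A B : Set X, A ∈ I → B ∈ I → A ∪ B ∈ I
  subset_mem : ∀ A B : Set X, A ⊆ B → B ∈ I → A ∈ I
  finite_mem : ∀ A : Set X, A.Finite → A ∈ I
  univ_notMem : Set.univ ∉ I

/-- `I` is generated by the family `G`. -/
def IsGeneratedBy {X : Type*} (I G : Set (Set X)) : Prop :=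
  G ⊆ I ∧ ∀ B ∈ I, ∃ G' : Set (Set X), G' ⊆ G ∧ G'.Finite ∧ B ⊆ ⋃₀ G'

/-- `I` is countably generated. -/
def IsCountablyGenerated {X : Type*} (I : Set (Set X)) : Prop :=
  ∃ G : Set (Set X), G.Countable ∧ IsGeneratedBy I G

/-- `I` (on `X`) and `J` (on `Y`) are isomorphic. -/
def Isomorphic {X Y : Type*} (I : Set (Set X)) (J : Set (Set Y)) : Prop :=
  ∃ f : Y → X, Function.Bijective f ∧ ∀ A : Set X, A ∈ I ↔ f ⁻¹' A ∈ J

/-- The ideal `Fin` of finite subsets of `ω`. -/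
def finIdeal : Set (Set ℕ) := {A | A.Finite}

/-- The ideal `I ⊕ 𝒫(ω)` on the disjoint sum of `S` and `ω`. -/
def sumPowerset {S : Type*} (I : Set (Set S)) : Set (Set (S ⊕ ℕ)) :=
  {M | {s : S | Sum.inl s ∈ M} ∈ I}

/-- The ideal `I ⊗ {∅}` on `S × ω`. -/
def prodEmpty {S : Type*} (I : Set (Set S)) : Set (Set (S × ℕ)) :=
  {M | {s : S | {n : ℕ | (s, n) ∈ M} ≠ ∅} ∈ I}

/-- `x` is `I`-convergent to `l`. -/
def IConverges {X : Type*} [TopologicalSpace X] (I : Set (Set ℕ)) (x : ℕ → X) (l : X) : Prop :=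
  ∀ U : Set X, IsOpen U → l ∈ U → {n : ℕ | x n ∉ U} ∈ I

/-- `I`-pointwise convergence of real functions. -/
def IPointwise {X : Type*} (I : Set (Set ℕ)) (f : ℕ → X → ℝ) (g : X → ℝ) : Prop :=
  ∀ x : X, IConverges I (fun n => f n x) (g x)

/-- `I`-uniform convergence of real functions. -/
def IUniform {X : Type*} (I : Set (Set ℕ)) (f : ℕ → X → ℝ) (g : X → ℝ) : Prop :=
  ∀ ε : ℝ, 0 < ε → {n : ℕ | ∃ x : X, ε ≤ |f n x - g x|} ∈ I

/-- `I` is an Egorov ideal. Lebesgue measurability of functions on `[0,1]` and of subsets of `[0,1]`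
is measurability with respect to the completion of `volume`, that is, null-measurability. -/
def IsEgorov (I : Set (Set ℕ)) : Prop :=
  ∀ (f : ℕ → Set.Icc (0 : ℝ) 1 → ℝ) (g : Set.Icc (0 : ℝ) 1 → ℝ),
    (∀ n, NullMeasurable (f n) volume) → NullMeasurable g volume → IPointwise I f g →
    ∀ η : ℝ, 0 < η → ∃ M : Set (Set.Icc (0 : ℝ) 1), NullMeasurableSet M volume ∧
      volume Mᶜ < ENNReal.ofReal η ∧ IUniform I (fun n (x : M) => f n x) (fun x : M => g x)

/-- `φ : 𝒫(ω) → [0,∞]` is a submeasure. -/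
structure IsSubmeasure (φ : Set ℕ → ℝ≥0∞) : Prop where
  empty : φ ∅ = 0
  singleton_lt_top : ∀ n : ℕ, φ {n} < ∞
  le_union : ∀ A B : Set ℕ, φ A ≤ φ (A ∪ B)
  union_le : ∀ A B : Set ℕ, φ (A ∪ B) ≤ φ A + φ B

/-- `φ` is the pointwise supremum of the (countably additive) measures on all subsets of `ω` that
it dominates. Every subset of `ℕ` is measurable for the instance used here. Such a `φ` is
automatically lower semicontinuous. -/
def IsNonpathological (φ : Set ℕ → ℝ≥0∞) : Prop :=
  ∀ A : Set ℕ, φ A = sSup {r | ∃ μ : Measure ℕ, (∀ B : Set ℕ, μ B ≤ φ B) ∧ r = μ A}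

/-- `Fin(φ)`. -/
def finOf (φ : Set ℕ → ℝ≥0∞) : Set (Set ℕ) := {A | φ A < ∞}

/-- `I` is a `Σ⁰₂` (that is, `F_σ`) subset of `𝒫(ω)`, identified with the Cantor space `ω → 2`
through characteristic functions. -/
def IsSigma02 (I : Set (Set ℕ)) : Prop :=
  ∃ F : ℕ → Set (ℕ → Bool), (∀ k, IsClosed (F k)) ∧
    {x : ℕ → Bool | {n : ℕ | x n = true} ∈ I} = ⋃ k, F k

/-- `I` is a non-pathological `Σ⁰₂` ideal on `ω`. -/
def IsNonpathologicalSigma02Ideal (I : Set (Set ℕ)) : Prop :=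
  IsIdealOn I ∧ IsSigma02 I ∧
    ∃ φ : Set ℕ → ℝ≥0∞, IsSubmeasure φ ∧ IsNonpathological φ ∧ I = finOf φ

/-- `I` is isomorphic to one of `Fin`, `Fin ⊕ 𝒫(ω)` and `Fin ⊗ {∅}`. -/
def IsIsomorphicToOneOfThree (I : Set (Set ℕ)) : Prop :=
  Isomorphic I finIdeal ∨ Isomorphic I (sumPowerset finIdeal) ∨ Isomorphic I (prodEmpty finIdeal)

end EgorovIdeals

/-! Countably generated ideals are families `boundedFamily h` of sets on which some unbounded `h` is
bounded; the three model ideals have this form. Egorov's classical argument works for them, with `h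
n` in place of the index `n`, and a case split on the infinite fibres of `h` leaves only the three
isomorphism types.

The hard direction is that an Egorov ideal `Fin(φ)` is countably generated. If it is not, then for
some `m` no countable subfamily of `Fin(φ)` captures all sets of submeasure at most `m`. The finite
lists whose supersets remain uncaptured form a tree in which the successors of each node have
infinite submeasure (`notMem_finOf_of_not_isCountablyCaptured`). Non-pathology gives measures below
`φ` that are large on these successors; after normalization they choose a successor at random, so
that a given `B` is hit at stage `k` with probability at most `φ B / k` (`exists_random_branch`).
Let `f n` indicate that `n` lies on the random branch. Each branch has submeasure at most `m`, so `f
n` converges pointwise to `0`. Uniform convergence on `M` puts the branches of all points of `M`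
inside one `B` with `φ B < ∞`, which forces `M` to be null. -/

namespace EgorovIdeals

/-! ### Ideals of sets on which a function is bounded -/

section BoundedFamily

/-- The family of all sets on which `h` is bounded. -/
def boundedFamily {X : Type*} (h : X → ℕ) : Set (Set X) :=
  {A | ∃ N, ∀ x ∈ A, h x ≤ N}

theorem finIdeal_eq_boundedFamily : finIdeal = boundedFamily (id : ℕ → ℕ) := by
  ext A
  constructor
  · intro hA
    obtain ⟨N, hN⟩ := Set.Finite.bddAbove hA
    exact ⟨N, fun x hx => hN hx⟩
  · rintro ⟨N, hN⟩
    exact (Set.finite_Iic N).subset hN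

theorem finite_iff_exists_le {A : Set ℕ} : A.Finite ↔ ∃ N, ∀ x ∈ A, x ≤ N :=
  Set.ext_iff.mp finIdeal_eq_boundedFamily A

theorem sumPowerset_finIdeal_eq_boundedFamily :
    sumPowerset finIdeal = boundedFamily (Sum.elim id (fun _ => 0) : ℕ ⊕ ℕ → ℕ) := by
  ext A
  refine (finite_iff_exists_le (A := {s | Sum.inl s ∈ A})).trans (exists_congr fun N => ?_)
  simp

theorem prodEmpty_finIdeal_eq_boundedFamily :
    prodEmpty finIdeal = boundedFamily (Prod.fst : ℕ × ℕ → ℕ) := by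
  ext A
  refine (finite_iff_exists_le (A := {s | {n : ℕ | (s, n) ∈ A} ≠ ∅})).trans
    (exists_congr fun N => ?_)
  simp only [ne_eq, ← Set.not_nonempty_iff_eq_empty, not_not, Set.mem_ofPred_eq, Prod.forall]
  exact ⟨fun H a b hab => H a ⟨b, hab⟩, fun H a ⟨b, hab⟩ => H a b hab⟩

theorem Isomorphic.exists_eq_boundedFamily {X Y : Type*} {I : Set (Set X)} {g : Y → ℕ}
    (hI : Isomorphic I (boundedFamily g)) (hg : ∀ N, ∃ y, N < g y) :
    ∃ h : X → ℕ, (∀ N, ∃ x, N < h x) ∧ I = boundedFamily h := by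
  obtain ⟨f, hf, hfI⟩ := hI
  let e := Equiv.ofBijective f hf
  refine ⟨g ∘ e.symm, fun N => ?_, ?_⟩
  · obtain ⟨y, hy⟩ := hg N
    exact ⟨e y, by simpa using hy⟩
  · ext A
    refine (hfI A).trans (exists_congr fun N => ?_)
    rw [← e.forall_congr_right (q := fun x => x ∈ A → (g ∘ e.symm) x ≤ N)]
    simp [e]

theorem IsIsomorphicToOneOfThree.exists_eq_boundedFamily {I : Set (Set ℕ)}
    (hI : IsIsomorphicToOneOfThree I) :
    ∃ h : ℕ → ℕ, (∀ N, ∃ x, N < h x) ∧ I = boundedFamily h := by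
  rcases hI with hI | hI | hI
  · rw [finIdeal_eq_boundedFamily] at hI
    exact hI.exists_eq_boundedFamily fun N => ⟨N + 1, N.lt_succ_self⟩
  · rw [sumPowerset_finIdeal_eq_boundedFamily] at hI
    exact hI.exists_eq_boundedFamily fun N => ⟨Sum.inl (N + 1), N.lt_succ_self⟩
  · rw [prodEmpty_finIdeal_eq_boundedFamily] at hI
    exact hI.exists_eq_boundedFamily fun N => ⟨(N + 1, 0), N.lt_succ_self⟩

theorem isIdealOn_boundedFamily {X : Type*} {h : X → ℕ} (hh : ∀ N, ∃ x, N < h x) :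
    IsIdealOn (boundedFamily h) where
  union_mem := by
    rintro A B ⟨N, hN⟩ ⟨K, hK⟩
    refine ⟨max N K, ?_⟩
    rintro x (hx | hx)
    · exact le_max_of_le_left (hN x hx)
    · exact le_max_of_le_right (hK x hx)
  subset_mem := fun A B hAB ⟨N, hN⟩ => ⟨N, fun x hx => hN x (hAB hx)⟩
  finite_mem := fun A hA => by
    obtain ⟨N, hN⟩ := (hA.image h).bddAbove
    exact ⟨N, fun x hx => hN (Set.mem_image_of_mem h hx)⟩
  univ_notMem := by
    rintro ⟨N, hN⟩
    obtain ⟨x, hx⟩ := hh N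
    exact hx.not_ge (hN x trivial)

theorem isSigma02_boundedFamily (h : ℕ → ℕ) : IsSigma02 (boundedFamily h) := by
  refine ⟨fun N => {x | ∀ k, x k = true → h k ≤ N}, fun N => ?_, ?_⟩
  · have : {x : ℕ → Bool | ∀ k, x k = true → h k ≤ N} =
        ⋂ k, (fun x : ℕ → Bool => x k) ⁻¹' {b | b = true → h k ≤ N} := by
      ext x; simp
    beta_reduce
    rw [this]
    refine isClosed_iInter fun k => ?_
    exact (isClosed_discrete {b : Bool | b = true → h k ≤ N}).preimage (continuous_apply k)
  · ext x
    simp [boundedFamily]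

/-- The submeasure is the supremum of `h` over the set; it is non-pathological as a supremum of the
point masses `h k • dirac k`. -/
theorem isNonpathologicalSigma02Ideal_boundedFamily {h : ℕ → ℕ} (hh : ∀ N, ∃ x, N < h x) :
    IsNonpathologicalSigma02Ideal (boundedFamily h) := by
  refine ⟨isIdealOn_boundedFamily hh, isSigma02_boundedFamily h,
    fun A => ⨆ k ∈ A, (h k : ℝ≥0∞), ⟨?_, ?_, ?_, ?_⟩, ?_, ?_⟩
  · simp
  · simp
  · exact fun A B => biSup_mono fun k hk => Or.inl hk
  · intro A B
    simp only [Set.mem_union, iSup_or, iSup_sup_eq]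
    exact max_le le_self_add le_add_self
  · intro A
    refine le_antisymm (iSup₂_le fun k hk => le_sSup ⟨(h k : ℝ≥0∞) • Measure.dirac k, ?_, ?_⟩)
      (sSup_le ?_)
    · intro B
      by_cases hkB : k ∈ B
      · simpa [hkB] using le_iSup₂ (f := fun k (_ : k ∈ B) => (h k : ℝ≥0∞)) k hkB
      · simp [hkB]
    · simp [hk]
    · rintro r ⟨μ, hμ, rfl⟩
      exact hμ A
  · ext A
    simp only [boundedFamily, finOf, Set.mem_ofPred_eq]
    constructor
    · rintro ⟨N, hN⟩
      exact (iSup₂_le fun k hk => Nat.cast_le.mpr (hN k hk) :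
        ⨆ k ∈ A, (h k : ℝ≥0∞) ≤ N).trans_lt (ENNReal.natCast_lt_top N)
    · intro hA
      obtain ⟨N, hN⟩ := ENNReal.exists_nat_gt hA.ne
      refine ⟨N, fun k hk => ?_⟩
      exact_mod_cast (le_iSup₂ (f := fun k (_ : k ∈ A) => (h k : ℝ≥0∞)) k hk).trans hN.le

/-- For fixed `k`, pointwise convergence bounds `h` on all the indices that are bad at `x`, so the
sets `E k N` decrease to `∅` and their measures tend to `0`. Discarding one small `E k (N k)` for
each `k` leaves `M`. -/
theorem isEgorov_boundedFamily (h : ℕ → ℕ) : IsEgorov (boundedFamily h) := by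
  intro f g hf hg hfg η hη
  let E : ℕ → ℕ → Set (Set.Icc (0 : ℝ) 1) := fun k N =>
    {x | ∃ n, N < h n ∧ 1 / ((k : ℝ) + 1) ≤ |f n x - g x|}
  have hE : ∀ k N, NullMeasurableSet (E k N) volume := by
    intro k N
    have : E k N = ⋃ n, {x | N < h n ∧ 1 / ((k : ℝ) + 1) ≤ |f n x - g x|} := by
      ext x; simp [E]
    rw [this]
    refine NullMeasurableSet.iUnion fun n => ?_
    by_cases hn : N < h n
    · simp only [hn, true_and]
      have h1 : AEMeasurable (fun x => |f n x - g x|) volume :=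
        ((hf n).aemeasurable.sub hg.aemeasurable).abs
      exact h1.nullMeasurable measurableSet_Ici
    · simp [hn]
  have hEanti : ∀ k, Antitone (E k) := fun k N N' hN x ⟨n, hn, hx⟩ => ⟨n, hN.trans_lt hn, hx⟩
  have hEempty : ∀ k, ⋂ N, E k N = ∅ := by
    intro k
    refine Set.eq_empty_of_forall_notMem fun x hx => ?_
    have hpos : (0 : ℝ) < 1 / ((k : ℝ) + 1) := by positivity
    obtain ⟨N, hN⟩ := hfg x (Metric.ball (g x) (1 / ((k : ℝ) + 1))) Metric.isOpen_ball
      (Metric.mem_ball_self hpos)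
    obtain ⟨n, hn, hnx⟩ := Set.mem_iInter.mp hx N
    refine hn.not_ge (hN n ?_)
    simpa [Real.dist_eq] using hnx
  obtain ⟨δ, hδ0, hδ⟩ := ENNReal.exists_pos_sum_of_countable (ι := ℕ)
    (ε := ENNReal.ofReal η) (by simpa using hη)
  have hN : ∀ k, ∃ N, volume (E k N) ≤ δ k := by
    intro k
    have := tendsto_measure_iInter_atTop (hE k) (hEanti k) ⟨0, measure_ne_top _ _⟩
    rw [hEempty, measure_empty] at this
    exact (this.eventually_le_const (by simpa using hδ0 k)).exists
  choose N hN using hN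
  refine ⟨(⋃ k, E k (N k))ᶜ, (NullMeasurableSet.iUnion fun k => hE k _).compl, ?_, ?_⟩
  · rw [compl_compl]
    exact ((measure_iUnion_le _).trans (ENNReal.tsum_le_tsum hN)).trans_lt hδ
  · intro ε hε
    obtain ⟨k, hk⟩ := exists_nat_one_div_lt hε
    refine ⟨N k, ?_⟩
    rintro n ⟨⟨x, hx⟩, hxn⟩
    by_contra! hn
    exact hx (Set.mem_iUnion.mpr ⟨k, n, hn, hk.le.trans hxn⟩)

end BoundedFamily

/-! ### Countably generated ideals and the three isomorphism types -/

section Classification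

theorem IsCountablyGenerated.exists_eq_boundedFamily {X : Type*} {I : Set (Set X)}
    (hI : IsIdealOn I) (hG : IsCountablyGenerated I) : ∃ h : X → ℕ, I = boundedFamily h := by
  classical
  obtain ⟨G, hGc, hGI, hcov⟩ := hG
  -- Adding `∅` allows an enumeration by `ℕ` even when `G` is empty.
  obtain ⟨u, hu⟩ := (hGc.insert ∅).exists_eq_range (Set.insert_nonempty ∅ G)
  have hempty : ∅ ∈ I := hI.finite_mem _ Set.finite_empty
  have huI : ∀ n, u n ∈ I := fun n => by
    have h1 : u n ∈ insert ∅ G := hu ▸ Set.mem_range_self n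
    rcases h1 with h1 | h1
    · rwa [h1]
    · exact hGI h1
  have hAI : ∀ n, (⋃ i ≤ n, u i) ∈ I := by
    intro n
    induction n with
    | zero => simpa using huI 0
    | succ n ih =>
      rw [Set.biUnion_le_succ]
      exact hI.union_mem _ _ ih (huI _)
  have hcov' : ∀ B ∈ I, ∃ n, B ⊆ ⋃ i ≤ n, u i := by
    intro B hB
    obtain ⟨G', hG', hfin, hBG⟩ := hcov B hB
    have hidx : ∀ A ∈ G', ∃ i, u i = A := fun A hA => by
      have h1 : A ∈ insert ∅ G := Or.inr (hG' hA)
      rwa [hu] at h1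
    choose! i hi using hidx
    obtain ⟨n, hn⟩ := (hfin.image i).bddAbove
    refine ⟨n, hBG.trans (Set.sUnion_subset fun A hA => ?_)⟩
    rw [← hi A hA]
    exact Set.subset_biUnion_of_mem (u := u) (show i A ≤ n from hn (Set.mem_image_of_mem i hA))
  have hmem : ∀ x, ∃ n, x ∈ u n := fun x => by
    obtain ⟨n, hn⟩ := hcov' {x} (hI.finite_mem _ (Set.finite_singleton x))
    obtain ⟨i, -, hi⟩ := Set.mem_iUnion₂.mp (hn rfl)
    exact ⟨i, hi⟩
  -- With `h x` the first index of a generator containing `x`, the sublevel sets of `h` are the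
  -- finite unions of initial generators.
  refine ⟨fun x => Nat.find (hmem x), ?_⟩
  ext B
  constructor
  · intro hB
    obtain ⟨n, hn⟩ := hcov' B hB
    refine ⟨n, fun x hx => ?_⟩
    obtain ⟨i, hi, hxi⟩ := Set.mem_iUnion₂.mp (hn hx)
    exact (Nat.find_min' (hmem x) hxi).trans hi
  · rintro ⟨n, hn⟩
    refine hI.subset_mem _ _ (fun x hx => ?_) (hAI n)
    exact Set.mem_iUnion₂.mpr ⟨_, hn x hx, Nat.find_spec (hmem x)⟩

theorem isomorphic_prodEmpty_of_infinite_fibers {h : ℕ → ℕ} (hh : ∀ n, (h ⁻¹' {n}).Infinite) :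
    Isomorphic (boundedFamily h) (prodEmpty finIdeal) := by
  have e : ∀ n, Nonempty (ℕ ≃ {x // h x = n}) := fun n => by
    have : Infinite {x // h x = n} := (hh n).to_subtype
    exact ⟨(nonempty_denumerable {x // h x = n}).some.eqv.symm⟩
  let e : ∀ n, ℕ ≃ {x // h x = n} := fun n => (e n).some
  let E : ℕ × ℕ ≃ ℕ :=
    ((Equiv.sigmaEquivProd ℕ ℕ).symm.trans (Equiv.sigmaCongrRight e)).trans
      (Equiv.sigmaFiberEquiv h)
  have hE : ∀ p : ℕ × ℕ, h (E p) = p.1 := fun p => (e p.1 p.2).2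
  refine ⟨E, E.bijective, fun A => ?_⟩
  rw [prodEmpty_finIdeal_eq_boundedFamily]
  refine exists_congr fun N => ?_
  rw [← E.forall_congr_right (q := fun x => x ∈ A → h x ≤ N)]
  simp only [hE, Set.mem_preimage]

theorem isomorphic_sumPowerset_of_infinite {I : Set (Set ℕ)} {A : Set ℕ} (hA : A.Infinite)
    (hAc : Aᶜ.Infinite) (hI : ∀ B, B ∈ I ↔ (B ∩ Aᶜ).Finite) :
    Isomorphic I (sumPowerset finIdeal) := by
  classical
  have : Infinite A := hA.to_subtype
  have : Infinite (Aᶜ : Set ℕ) := hAc.to_subtype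
  let e₁ : ℕ ≃ (Aᶜ : Set ℕ) := (nonempty_denumerable (Aᶜ : Set ℕ)).some.eqv.symm
  let e₂ : ℕ ≃ A := (nonempty_denumerable A).some.eqv.symm
  let E : ℕ ⊕ ℕ ≃ ℕ :=
    ((Equiv.sumCongr e₁ e₂).trans (Equiv.sumComm _ _)).trans (Equiv.Set.sumCompl A)
  refine ⟨E, E.bijective, fun B => (hI B).trans ?_⟩
  have h1 : B ∩ Aᶜ = (fun n => (e₁ n : ℕ)) '' {n | Sum.inl n ∈ E ⁻¹' B} := by
    ext x
    constructor
    · rintro ⟨hxB, hxA⟩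
      refine ⟨e₁.symm ⟨x, hxA⟩, ?_, by simp⟩
      simpa [E] using hxB
    · rintro ⟨n, hn, rfl⟩
      exact ⟨by simpa [E] using hn, (e₁ n).2⟩
  rw [h1]
  exact Set.finite_image_iff (Subtype.val_injective.comp e₁.injective).injOn

theorem isIsomorphicToOneOfThree_boundedFamily {h : ℕ → ℕ} (hh : ∀ N, ∃ x, N < h x) :
    IsIsomorphicToOneOfThree (boundedFamily h) := by
  classical
  let P : ℕ → Prop := fun n => (h ⁻¹' {n}).Infinite
  by_cases hP : (Set.ofPred P).Infinite
  · have hbdd : boundedFamily h = boundedFamily fun x => Nat.count P (h x) := by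
      ext A
      constructor
      · rintro ⟨N, hN⟩
        exact ⟨Nat.count P N, fun x hx => Nat.count_monotone P (hN x hx)⟩
      · rintro ⟨N, hN⟩
        exact ⟨Nat.nth P N, fun x hx => (Nat.count_le_iff_le_nth hP).mp (hN x hx)⟩
    rw [hbdd]
    refine Or.inr (Or.inr (isomorphic_prodEmpty_of_infinite_fibers fun n => ?_))
    refine (Nat.nth_mem_of_infinite hP n : (h ⁻¹' {Nat.nth P n}).Infinite).mono fun x hx => ?_
    rw [Set.mem_preimage, Set.mem_singleton_iff] at hx ⊢
    rw [hx, Nat.count_nth_of_infinite hP]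
  · obtain ⟨N, hN⟩ := finite_iff_exists_le.mp (Set.not_infinite.mp hP)
    -- All fibres above `N` are finite, so outside `{x | h x ≤ N}` bounded means finite. Whether
    -- this sublevel set is finite separates the two remaining types.
    have hI : ∀ B, B ∈ boundedFamily h ↔ (B ∩ {x | h x ≤ N}ᶜ).Finite := by
      intro B
      constructor
      · rintro ⟨K, hK⟩
        refine ((Set.finite_Ioc N K).biUnion fun n hn => ?_ :
          (⋃ n ∈ Set.Ioc N K, h ⁻¹' {n}).Finite).subset ?_
        · by_contra hinf
          exact hn.1.not_ge (hN n hinf)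
        · rintro x ⟨hxB, hxN⟩
          exact Set.mem_iUnion₂.mpr ⟨h x, ⟨not_le.mp hxN, hK x hxB⟩, rfl⟩
      · intro hB
        have hI := isIdealOn_boundedFamily hh
        have hN : {x | h x ≤ N} ∈ boundedFamily h := ⟨N, fun x hx => hx⟩
        refine hI.subset_mem _ _ ?_ (hI.union_mem _ _ (hI.finite_mem _ hB) hN)
        intro x hx
        by_cases hxN : h x ≤ N
        · exact Or.inr hxN
        · exact Or.inl ⟨hx, hxN⟩
    have hAc : ({x | h x ≤ N}ᶜ).Infinite := fun hfin =>
      (isIdealOn_boundedFamily hh).univ_notMem ((hI _).mpr (by simpa using hfin))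
    by_cases hA : {x | h x ≤ N}.Finite
    · refine Or.inl ⟨id, Function.bijective_id, fun B => (hI B).trans ?_⟩
      refine ⟨fun hB => (hB.union hA).subset fun x hx => ?_, fun hB => hB.subset (by simp)⟩
      by_cases hxN : h x ≤ N
      · exact Or.inr hxN
      · exact Or.inl ⟨hx, hxN⟩
    · exact Or.inr (Or.inl (isomorphic_sumPowerset_of_infinite hA hAc hI))

theorem not_isomorphic_finIdeal {Y : Type*} {J : Set (Set Y)} {B : Set Y} (hB : B ∈ J)
    (hBinf : B.Infinite) : ¬ Isomorphic finIdeal J := by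
  rintro ⟨f, hf, hfJ⟩
  refine hBinf (Set.Finite.of_finite_image (f := f) ?_ hf.1.injOn)
  refine (hfJ (f '' B)).mpr ?_
  rwa [Set.preimage_image_eq B hf.1]

theorem not_isomorphic_finIdeal_sumPowerset : ¬ Isomorphic finIdeal (sumPowerset finIdeal) := by
  refine not_isomorphic_finIdeal (B := Set.range Sum.inr) ?_
    (Set.infinite_range_of_injective Sum.inr_injective)
  simp [sumPowerset, finIdeal]

theorem not_isomorphic_finIdeal_prodEmpty : ¬ Isomorphic finIdeal (prodEmpty finIdeal) := by
  rw [prodEmpty_finIdeal_eq_boundedFamily]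
  exact not_isomorphic_finIdeal (B := Set.range (Prod.mk 0)) ⟨0, by simp⟩
    (Set.infinite_range_of_injective (Prod.mk_right_injective 0))

/-- An isomorphism would place the copy of the right summand in columns up to some `N`. Column `N +
1` is in the ideal, yet its image would lie in the left summand, where members have only finitely
many points. -/
theorem not_isomorphic_sumPowerset_prodEmpty :
    ¬ Isomorphic (sumPowerset finIdeal) (prodEmpty finIdeal) := by
  rw [prodEmpty_finIdeal_eq_boundedFamily]
  rintro ⟨f, hf, hfI⟩
  have h0 : (Set.range Sum.inr : Set (ℕ ⊕ ℕ)) ∈ sumPowerset finIdeal := by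
    simp [sumPowerset, finIdeal]
  obtain ⟨N, hN⟩ := (hfI _).mp h0
  have h1 : f '' (Set.range (Prod.mk (N + 1))) ∈ sumPowerset finIdeal := by
    rw [hfI, Set.preimage_image_eq _ hf.1]
    exact ⟨N + 1, by simp⟩
  refine (Set.infinite_range_of_injective (Prod.mk_right_injective (N + 1)))
    (Set.Finite.of_finite_image (f := f) ?_ hf.1.injOn)
  refine ((h1 : Set.Finite _).image Sum.inl).subset ?_
  rintro _ ⟨_, ⟨n, rfl⟩, rfl⟩
  rcases hy : f (N + 1, n) with s | s
  · exact ⟨s, ⟨_, ⟨n, rfl⟩, hy⟩, rfl⟩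
  · have := hN (N + 1, n) ⟨s, hy.symm⟩
    simp at this

end Classification

/-! ### Splitting subsets of the unit interval into pieces of prescribed measure -/

section Splitting

/-- The measure of `E` to the left of `s` is 1-Lipschitz in `s`, so the intermediate value theorem
applies. -/
theorem exists_measurableSet_subset_volume_eq {E : Set (Set.Icc (0 : ℝ) 1)} (hE : MeasurableSet E)
    {t : ℝ≥0∞} (ht : t ≤ volume E) : ∃ A ⊆ E, MeasurableSet A ∧ volume A = t := by
  let E' : Set ℝ := Subtype.val '' E
  have hE' : MeasurableSet E' := measurableSet_Icc.subtype_image hE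
  have hvol : ∀ B : Set (Set.Icc (0 : ℝ) 1), volume B = volume (Subtype.val '' B : Set ℝ) :=
    fun B => unitInterval.volume_apply
  let F : ℝ → ℝ := fun s => volume.real (E' ∩ Set.Iic s)
  have hfin : ∀ s, volume (E' ∩ Set.Iic s) ≠ ∞ := fun s =>
    ((measure_mono (Set.inter_subset_left.trans (Subtype.coe_image_subset _ E))).trans_lt
      (by simp : volume (Set.Icc (0 : ℝ) 1) < ∞)).ne
  have hstep : ∀ s s', s ≤ s' → F s ≤ F s' ∧ F s' ≤ F s + (s' - s) := by
    intro s s' hss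
    refine ⟨ENNReal.toReal_mono (hfin s')
      (measure_mono (Set.inter_subset_inter_right _ (Set.Iic_subset_Iic.mpr hss))), ?_⟩
    have h1 : E' ∩ Set.Iic s' ⊆ (E' ∩ Set.Iic s) ∪ Set.Ioc s s' := by
      rintro x ⟨hx, hxs⟩
      rcases le_or_gt x s with h | h
      · exact Or.inl ⟨hx, h⟩
      · exact Or.inr ⟨h, hxs⟩
    have h2 := (measure_mono h1).trans (measure_union_le (μ := volume) _ _)
    have h3 := ENNReal.toReal_mono (by simp [hfin s]) h2
    rwa [ENNReal.toReal_add (hfin s) (by simp), Real.volume_Ioc,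
      ENNReal.toReal_ofReal (sub_nonneg.mpr hss)] at h3
  have hcont : Continuous F := by
    refine LipschitzWith.continuous (K := 1) (LipschitzWith.of_dist_le_mul fun s s' => ?_)
    rw [Real.dist_eq, Real.dist_eq, NNReal.coe_one, one_mul]
    rcases le_total s s' with h | h
    · obtain ⟨h1, h2⟩ := hstep s s' h
      rw [abs_sub_comm, abs_of_nonneg (by linarith), abs_sub_comm, abs_of_nonneg (by linarith)]
      linarith
    · obtain ⟨h1, h2⟩ := hstep s' s h
      rw [abs_of_nonneg (by linarith), abs_of_nonneg (by linarith)]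
      linarith
  have hF0 : F 0 = 0 := by
    refine (ENNReal.toReal_eq_zero_iff _).mpr (Or.inl (measure_mono_null (t := {(0 : ℝ)}) ?_ ?_))
    · rintro _ ⟨⟨x, -, rfl⟩, hx⟩
      exact le_antisymm hx x.2.1
    · simp
  have hF1 : F 1 = (volume E).toReal := by
    rw [hvol E]
    refine congrArg (fun B => (volume B).toReal) (Set.inter_eq_left.mpr ?_)
    rintro _ ⟨x, -, rfl⟩
    exact x.2.2
  have ht' : t ≠ ∞ := (ht.trans_lt (measure_lt_top _ _)).ne
  obtain ⟨s, -, hs⟩ := intermediate_value_Icc zero_le_one hcont.continuousOn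
    (show t.toReal ∈ Set.Icc (F 0) (F 1) from
      ⟨hF0.le.trans ENNReal.toReal_nonneg,
        (ENNReal.toReal_mono (measure_ne_top _ _) ht).trans hF1.ge⟩)
  refine ⟨E ∩ Subtype.val ⁻¹' Set.Iic s, Set.inter_subset_left,
    hE.inter (measurable_subtype_coe measurableSet_Iic), ?_⟩
  rw [hvol, Set.image_inter_preimage]
  exact (ENNReal.toReal_eq_toReal_iff' (hfin s) ht').mp hs

theorem exists_measurable_volume_fiber_eq {F : Finset ℕ} (hF : F.Nonempty) (w : ℕ → ℝ≥0∞) :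
    ∀ {E : Set (Set.Icc (0 : ℝ) 1)}, MeasurableSet E → ∑ n ∈ F, w n = volume E →
    ∃ h : Set.Icc (0 : ℝ) 1 → ℕ, Measurable h ∧ (∀ x, h x ∈ F) ∧
      ∀ n ∈ F, volume (E ∩ h ⁻¹' {n}) = w n := by
  classical
  induction hF using Finset.Nonempty.cons_induction with
  | singleton a =>
    intro E hE hw
    refine ⟨fun _ => a, measurable_const, by simp, ?_⟩
    simpa using hw.symm
  | cons a F haF hF ih =>
    intro E hE hw
    rw [Finset.sum_cons] at hw
    obtain ⟨A, hAE, hA, hAw⟩ :=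
      exists_measurableSet_subset_volume_eq hE (hw ▸ le_self_add : w a ≤ volume E)
    obtain ⟨h, hh, hhF, hhw⟩ := ih (hE.diff hA) (by
      rw [measure_sdiff hAE hA.nullMeasurableSet (measure_ne_top _ _), ← hw, hAw]
      exact (ENNReal.add_sub_cancel_left (hAw ▸ measure_ne_top _ _)).symm)
    refine ⟨A.piecewise (fun _ => a) h, measurable_const.piecewise hA hh, fun x => ?_,
      fun n hn => ?_⟩
    · by_cases hx : x ∈ A
      · simp [hx]
      · simp [hx, hhF x]
    · rcases Finset.mem_cons.mp hn with rfl | hnF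
      · rw [← hAw]
        congr 1
        ext x
        by_cases hx : x ∈ A
        · simp [hx, hAE hx]
        · simpa [hx] using fun _ (hxn : h x = n) => haF (hxn ▸ hhF x)
      · rw [← hhw n hnF]
        congr 1
        ext x
        by_cases hx : x ∈ A
        · simpa [hx] using fun _ (han : a = n) => haF (han ▸ hnF)
        · simp [hx]

end Splitting

/-! ### Random branches through trees with large successor sets -/

section RandomBranch

variable {φ : Set ℕ → ℝ≥0∞}

theorem measure_nat_le_of_finset_le (μ : Measure ℕ) {A : Set ℕ} {c : ℝ≥0∞}
    (h : ∀ F : Finset ℕ, ↑F ⊆ A → μ F ≤ c) : μ A ≤ c := by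
  classical
  rw [← Measure.tsum_indicator_apply_singleton μ A (MeasurableSet.of_discrete),
    ENNReal.tsum_eq_iSup_sum]
  refine iSup_le fun F => ?_
  refine le_trans (le_of_eq ?_) (h {n ∈ F | n ∈ A} (fun n hn => (Finset.mem_filter.mp hn).2))
  rw [← sum_measure_singleton, Finset.sum_filter]
  simp [Set.indicator_apply]

theorem IsNonpathological.le_of_finset_le (hφ : IsNonpathological φ) {A : Set ℕ} {c : ℝ≥0∞}
    (h : ∀ F : Finset ℕ, ↑F ⊆ A → φ F ≤ c) : φ A ≤ c := by
  rw [hφ A]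
  refine sSup_le ?_
  rintro r ⟨μ, hμ, rfl⟩
  exact measure_nat_le_of_finset_le μ fun F hF => (hμ F).trans (h F hF)

/-- Some measure `μ ≤ φ` exceeds `K` on a finite `F ⊆ S`. Distributing `h` over `F` in proportion to
`μ` makes the conditional probability of `h ∈ B` given `E` at most `φ B / μ F`. -/
theorem exists_measurable_mul_volume_le (hs : IsSubmeasure φ) (hφ : IsNonpathological φ)
    {S : Set ℕ} (hS : S ∉ finOf φ) (K : ℕ) {E : Set (Set.Icc (0 : ℝ) 1)} (hE : MeasurableSet E) :
    ∃ h : Set.Icc (0 : ℝ) 1 → ℕ, Measurable h ∧ (∀ x, h x ∈ S) ∧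
      ∀ B : Set ℕ, K * volume (E ∩ h ⁻¹' B) ≤ φ B * volume E := by
  classical
  have hS : φ S = ∞ := not_lt_top_iff.mp hS
  obtain ⟨_, ⟨μ, hμ, rfl⟩, hK⟩ := lt_sSup_iff.mp
    (show (K : ℝ≥0∞) < sSup _ from hφ S ▸ hS ▸ ENNReal.natCast_lt_top K)
  obtain ⟨F, hFS, hF⟩ : ∃ F : Finset ℕ, ↑F ⊆ S ∧ (K : ℝ≥0∞) < μ F := by
    by_contra! H
    exact hK.not_ge (measure_nat_le_of_finset_le μ H)
  have hF0 : μ F ≠ 0 := (pos_of_gt hF).ne'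
  have hFtop : μ F ≠ ∞ := by
    rw [← sum_measure_singleton]
    exact (ENNReal.sum_lt_top.mpr fun n _ => (hμ {n}).trans_lt (hs.singleton_lt_top n)).ne
  have hFne : F.Nonempty := by
    rw [Finset.nonempty_iff_ne_empty]
    rintro rfl
    simp at hF0
  have hsum : ∀ G : Finset ℕ, ∑ n ∈ G, μ {n} / μ F * volume E = μ G / μ F * volume E := by
    intro G
    rw [← sum_measure_singleton (s := G)]
    simp only [ENNReal.div_eq_inv_mul, Finset.mul_sum, Finset.sum_mul]
  obtain ⟨h, hh, hhF, hhw⟩ := exists_measurable_volume_fiber_eq hFne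
    (fun n => μ {n} / μ F * volume E) hE (by rw [hsum, ENNReal.div_self hF0 hFtop, one_mul])
  refine ⟨h, hh, fun x => hFS (hhF x), fun B => ?_⟩
  have h1 : E ∩ h ⁻¹' B ⊆ ⋃ n ∈ F.filter (· ∈ B), E ∩ h ⁻¹' {n} := by
    rintro x ⟨hxE, hxB⟩
    exact Set.mem_iUnion₂.mpr ⟨h x, Finset.mem_filter.mpr ⟨hhF x, hxB⟩, hxE, rfl⟩
  have h2 : volume (E ∩ h ⁻¹' B) ≤ φ B / μ F * volume E := by
    refine ((measure_mono h1).trans (measure_biUnion_finset_le _ _)).trans ?_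
    rw [Finset.sum_congr rfl fun n hn => hhw n (Finset.mem_filter.mp hn).1, hsum]
    gcongr
    exact (measure_mono (fun n hn => (Finset.mem_filter.mp hn).2)).trans (hμ B)
  calc K * volume (E ∩ h ⁻¹' B) ≤ μ F * (φ B / μ F * volume E) := by gcongr
    _ = φ B * volume E := by rw [← mul_assoc, ENNReal.mul_div_cancel hF0 hFtop]

theorem exists_measurable_extension (hs : IsSubmeasure φ) (hφ : IsNonpathological φ)
    {T : List ℕ → Prop} (hT : ∀ l, T l → {n | T (n :: l)} ∉ finOf φ) (K : ℕ)
    {L : Set.Icc (0 : ℝ) 1 → List ℕ} (hL : ∀ l, MeasurableSet (L ⁻¹' {l})) (hLT : ∀ x, T (L x)) :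
    ∃ h : Set.Icc (0 : ℝ) 1 → ℕ, Measurable h ∧ (∀ x, T (h x :: L x)) ∧
      ∀ B : Set ℕ, K * volume (h ⁻¹' B) ≤ φ B := by
  have hex : ∀ l, ∃ h : Set.Icc (0 : ℝ) 1 → ℕ, Measurable h ∧ (T l → ∀ x, T (h x :: l)) ∧
      ∀ B : Set ℕ, K * volume (L ⁻¹' {l} ∩ h ⁻¹' B) ≤ φ B * volume (L ⁻¹' {l}) := by
    intro l
    by_cases hl : T l
    · obtain ⟨h, hh, hhS, hhB⟩ := exists_measurable_mul_volume_le hs hφ (hT l hl) K (hL l)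
      exact ⟨h, hh, fun _ => hhS, hhB⟩
    · refine ⟨fun _ => 0, measurable_const, fun h => absurd h hl, fun B => ?_⟩
      have : L ⁻¹' {l} = ∅ := Set.eq_empty_of_forall_notMem fun x hx => hl (hx ▸ hLT x)
      simp [this]
  choose h hh hhT hhB using hex
  -- The level sets of `L` form a countable measurable partition; the estimates on the pieces are
  -- weighted by their volumes and sum to the global one.
  have hpre : ∀ B : Set ℕ, (fun x => h (L x) x) ⁻¹' B = ⋃ l, L ⁻¹' {l} ∩ h l ⁻¹' B := by
    intro B
    ext x
    simp
  refine ⟨fun x => h (L x) x, fun B hB => ?_, fun x => hhT _ (hLT x) x, fun B => ?_⟩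
  · rw [hpre]
    exact MeasurableSet.iUnion fun l => (hL l).inter (hh l hB)
  · rw [hpre]
    calc K * volume (⋃ l, L ⁻¹' {l} ∩ h l ⁻¹' B)
        ≤ K * ∑' l, volume (L ⁻¹' {l} ∩ h l ⁻¹' B) := by
          gcongr
          exact measure_iUnion_le _
      _ ≤ ∑' l, φ B * volume (L ⁻¹' {l}) := by
          rw [← ENNReal.tsum_mul_left]
          exact ENNReal.tsum_le_tsum fun l => hhB l B
      _ = φ B := by
          rw [ENNReal.tsum_mul_left, ← measure_iUnion _ hL, ← Set.preimage_iUnion]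
          · rw [Set.iUnion_of_singleton, Set.preimage_univ, measure_univ, mul_one]
          · intro l l' hll
            exact (Set.disjoint_singleton.mpr hll).preimage L

theorem exists_random_branch (hs : IsSubmeasure φ) (hφ : IsNonpathological φ)
    {T : List ℕ → Prop} (hT0 : T []) (hT : ∀ l, T l → {n | T (n :: l)} ∉ finOf φ) :
    ∃ h : ℕ → Set.Icc (0 : ℝ) 1 → ℕ, (∀ k, Measurable (h k)) ∧
      (∀ x k, ∃ l, T l ∧ ∀ i < k, h i x ∈ l) ∧ ∀ k B, k * volume (h k ⁻¹' B) ≤ φ B := by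
  let P : (Set.Icc (0 : ℝ) 1 → List ℕ) → Prop :=
    fun L => (∀ l, MeasurableSet (L ⁻¹' {l})) ∧ ∀ x, T (L x)
  have hex : ∀ (K : ℕ) (L : {L // P L}), ∃ h : Set.Icc (0 : ℝ) 1 → ℕ, Measurable h ∧
      (∀ x, T (h x :: L.1 x)) ∧ ∀ B : Set ℕ, K * volume (h ⁻¹' B) ≤ φ B :=
    fun K L => exists_measurable_extension hs hφ hT K L.2.1 L.2.2
  choose e he heT heB using hex
  have hstep : ∀ K L, P fun x => e K L x :: L.1 x := by
    refine fun K L => ⟨fun l => ?_, heT K L⟩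
    cases l with
    | nil =>
      convert MeasurableSet.empty
      ext x
      simp
    | cons n l =>
      convert (he K L (measurableSet_singleton n)).inter (L.2.1 l)
      ext x
      simp
  -- Stage `K` extends the branch with constant `K`, newest entry at the head of the list.
  let L : ℕ → {L // P L} := fun k => Nat.rec
    ⟨fun _ => [], fun l => MeasurableSet.const _, fun _ => hT0⟩
    (fun K L => ⟨_, hstep K L⟩) k
  have hL : ∀ k x, (L (k + 1)).1 x = e k (L k) x :: (L k).1 x := fun k x => rfl
  refine ⟨fun k => e k (L k), fun k => he k _, fun x k => ⟨(L k).1 x, (L k).2.2 x, ?_⟩,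
    fun k => heB k _⟩
  induction k with
  | zero => simp
  | succ k ih =>
    intro i hi
    rw [hL]
    rcases Nat.lt_succ_iff_lt_or_eq.mp hi with hi | rfl
    · exact List.mem_cons_of_mem _ (ih i hi)
    · exact List.mem_cons_self

end RandomBranch

/-! ### Egorov ideals are countably generated -/

section EgorovImpliesCountablyGenerated

variable {φ : Set ℕ → ℝ≥0∞}

/-- The sets of submeasure at most `c` that contain `s` are captured by a countable subfamily of
`Fin(φ)`. -/
def IsCountablyCaptured (φ : Set ℕ → ℝ≥0∞) (c : ℝ≥0∞) (s : Set ℕ) : Prop :=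
  ∃ G : Set (Set ℕ), G.Countable ∧ G ⊆ finOf φ ∧ ∀ A, φ A ≤ c → s ⊆ A → ∃ B ∈ G, A ⊆ B

theorem le_of_not_isCountablyCaptured (hs : IsSubmeasure φ) {c : ℝ≥0∞} {s : Set ℕ}
    (h : ¬ IsCountablyCaptured φ c s) : φ s ≤ c := by
  by_contra! hc
  refine h ⟨∅, Set.countable_empty, Set.empty_subset _, fun A hA hsA => absurd hA ?_⟩
  have := hs.le_union s A
  rw [Set.union_eq_self_of_subset_left hsA] at this
  exact (hc.trans_le this).not_ge

/-- Otherwise the set of uncaptured successors could itself join the capturing families of the other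
successors: a set `A ⊇ s` either lies inside it or contains some `n` with `insert n s` captured.
Together these would capture `s`. -/
theorem notMem_finOf_of_not_isCountablyCaptured {c : ℝ≥0∞} {s : Set ℕ}
    (h : ¬ IsCountablyCaptured φ c s) :
    {n | ¬ IsCountablyCaptured φ c (insert n s)} ∉ finOf φ := by
  intro hB
  refine h ?_
  choose! G hGc hGI hG using fun n (hn : IsCountablyCaptured φ c (insert n s)) => hn
  refine ⟨insert {n | ¬ IsCountablyCaptured φ c (insert n s)}
    (⋃ n ∈ {n | IsCountablyCaptured φ c (insert n s)}, G n), ?_, ?_, ?_⟩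
  · exact ((Set.to_countable _).biUnion hGc).insert _
  · exact Set.insert_subset hB (Set.iUnion₂_subset hGI)
  · intro A hA hsA
    by_cases hAB : A ⊆ {n | ¬ IsCountablyCaptured φ c (insert n s)}
    · exact ⟨_, Set.mem_insert _ _, hAB⟩
    · obtain ⟨n, hnA, hn⟩ := Set.not_subset.mp hAB
      have hn : IsCountablyCaptured φ c (insert n s) := not_not.mp hn
      obtain ⟨B, hB, hAB⟩ := hG n hn A hA (Set.insert_subset hnA hsA)
      exact ⟨B, Or.inr (Set.mem_iUnion₂.mpr ⟨n, hn, hB⟩), hAB⟩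

theorem isCountablyGenerated_of_isCountablyCaptured
    (h : ∀ m : ℕ, IsCountablyCaptured φ m ∅) : IsCountablyGenerated (finOf φ) := by
  choose G hGc hGI hG using h
  refine ⟨⋃ m, G m, Set.countable_iUnion hGc, Set.iUnion_subset hGI, fun A hA => ?_⟩
  obtain ⟨m, hm⟩ := ENNReal.exists_nat_gt (ne_of_lt hA)
  obtain ⟨B, hB, hAB⟩ := hG m A hm.le (Set.empty_subset A)
  exact ⟨{B}, by simpa using ⟨m, hB⟩, Set.finite_singleton B, by simpa using hAB⟩

theorem IsEgorov.isCountablyGenerated (hs : IsSubmeasure φ) (hφ : IsNonpathological φ)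
    (hE : IsEgorov (finOf φ)) : IsCountablyGenerated (finOf φ) := by
  classical
  by_contra hI
  obtain ⟨m, hm⟩ : ∃ m : ℕ, ¬ IsCountablyCaptured φ m ∅ := by
    by_contra! H
    exact hI (isCountablyGenerated_of_isCountablyCaptured H)
  have hmono : ∀ {A B : Set ℕ}, A ⊆ B → φ A ≤ φ B := fun {A B} hAB => by
    simpa [Set.union_eq_self_of_subset_left hAB] using hs.le_union A B
  obtain ⟨h, hh, hbr, hhB⟩ := exists_random_branch hs hφ
    (T := fun l => ¬ IsCountablyCaptured φ m {n | n ∈ l}) (by simpa using hm) (fun l hl => by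
      have h1 : ∀ n, {k | k ∈ n :: l} = insert n {k | k ∈ l} := fun n => by ext; simp
      simpa only [h1] using notMem_finOf_of_not_isCountablyCaptured hl)
  -- Every finite part of a branch lies in a node of the tree, hence has submeasure at most `m`;
  -- non-pathology passes this bound to the whole branch.
  have hX : ∀ x, Set.range (fun k => h k x) ∈ finOf φ := fun x => by
    refine (hφ.le_of_finset_le fun F hF => ?_ : φ (Set.range fun k => h k x) ≤ m).trans_lt
      (ENNReal.natCast_lt_top m)
    have hF : ∀ n ∈ F, ∃ k, h k x = n := fun n hn => hF hn
    choose! i hi using hF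
    obtain ⟨k, hk⟩ : ∃ k, ∀ n ∈ F, i n < k :=
      ⟨F.sup i + 1, fun n hn => Nat.lt_succ_of_le (Finset.le_sup hn)⟩
    obtain ⟨l, hl, hlk⟩ := hbr x k
    refine le_trans (hmono fun n hn => ?_) (le_of_not_isCountablyCaptured hs hl)
    have := hlk (i n) (hk n hn)
    rwa [show h (i n) x = n from hi n hn] at this
  let f : ℕ → Set.Icc (0 : ℝ) 1 → ℝ := fun n => Set.indicator (⋃ k, h k ⁻¹' {n}) 1
  have hf : ∀ n, Measurable (f n) := fun n =>
    measurable_one.indicator (MeasurableSet.iUnion fun k => hh k (measurableSet_singleton n))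
  obtain ⟨M, hM, hMvol, hMI⟩ := hE f 0 (fun n => (hf n).nullMeasurable)
    measurable_zero.nullMeasurable (fun x U _ hU => by
      refine (hmono fun n hn => ?_).trans_lt (hX x)
      by_contra hnx
      refine hn ?_
      have : f n x = 0 := Set.indicator_of_notMem (by simpa using hnx) _
      exact (congrArg (· ∈ U) this).mpr hU) 1 one_pos
  let B : Set ℕ := {n | ∃ x : M, 1 ≤ |f n x - (0 : Set.Icc (0 : ℝ) 1 → ℝ) x|}
  have hB : φ B < ∞ := hMI 1 one_pos
  -- For `x ∈ M`, the index `h k x` is on the branch of `x`, so `f (h k x) x = 1` witnesses that it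
  -- belongs to `B`.
  have hMB : ∀ k, M ⊆ h k ⁻¹' B := fun k x hx => by
    refine ⟨⟨x, hx⟩, ?_⟩
    have : f (h k x) x = 1 :=
      Set.indicator_of_mem (show x ∈ ⋃ i, h i ⁻¹' {h k x} from Set.mem_iUnion.mpr ⟨k, rfl⟩) _
    simp [this]
  have hM0 : volume M = 0 := by
    by_contra hM0
    obtain ⟨k, hk⟩ := ENNReal.exists_nat_mul_gt hM0 hB.ne
    exact hk.not_ge ((mul_le_mul_right (measure_mono (hMB k)) _).trans (hhB k B))
  have h1 : volume (Set.univ : Set (Set.Icc (0 : ℝ) 1)) = 1 := measure_univ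
  rw [← Set.union_compl_self M] at h1
  have h2 := h1 ▸ measure_union_le (μ := volume) M Mᶜ
  rw [hM0, zero_add] at h2
  simp only [ENNReal.ofReal_one] at hMvol
  exact hMvol.not_ge h2

end EgorovImpliesCountablyGenerated

end EgorovIdeals

theorem mainTheorem1 :
    -- the three conditions are equivalent
    (∀ I : Set (Set ℕ), EgorovIdeals.IsNonpathologicalSigma02Ideal I →
      List.TFAE
        [EgorovIdeals.IsEgorov I,
          EgorovIdeals.IsCountablyGenerated I,
          EgorovIdeals.IsIsomorphicToOneOfThree I]) ∧
    -- all copies on `ω` of the three ideals are non-pathological `Σ⁰₂` Egorov ideals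
    (∀ I : Set (Set ℕ), EgorovIdeals.IsIsomorphicToOneOfThree I →
      EgorovIdeals.IsNonpathologicalSigma02Ideal I ∧ EgorovIdeals.IsEgorov I) ∧
    -- the three ideals are pairwise non-isomorphic
    ¬ EgorovIdeals.Isomorphic EgorovIdeals.finIdeal
        (EgorovIdeals.sumPowerset EgorovIdeals.finIdeal) ∧
    ¬ EgorovIdeals.Isomorphic EgorovIdeals.finIdeal
        (EgorovIdeals.prodEmpty EgorovIdeals.finIdeal) ∧
    ¬ EgorovIdeals.Isomorphic (EgorovIdeals.sumPowerset EgorovIdeals.finIdeal)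
        (EgorovIdeals.prodEmpty EgorovIdeals.finIdeal) := by
  open EgorovIdeals in
  have hthree : ∀ I : Set (Set ℕ), IsIsomorphicToOneOfThree I →
      IsNonpathologicalSigma02Ideal I ∧ IsEgorov I := by
    intro I hI
    obtain ⟨h, hh, rfl⟩ := hI.exists_eq_boundedFamily
    exact ⟨isNonpathologicalSigma02Ideal_boundedFamily hh, isEgorov_boundedFamily h⟩
  refine ⟨fun I hI => ?_, hthree, EgorovIdeals.not_isomorphic_finIdeal_sumPowerset,
    EgorovIdeals.not_isomorphic_finIdeal_prodEmpty,
    EgorovIdeals.not_isomorphic_sumPowerset_prodEmpty⟩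
  tfae_have 1 → 2 := by
    intro hE
    obtain ⟨-, -, φ, hs, hφ, rfl⟩ := hI
    exact hE.isCountablyGenerated hs hφ
  tfae_have 2 → 3 := by
    intro hG
    obtain ⟨h, rfl⟩ := hG.exists_eq_boundedFamily hI.1
    refine EgorovIdeals.isIsomorphicToOneOfThree_boundedFamily fun N => ?_
    by_contra! H
    exact hI.1.univ_notMem ⟨N, fun x _ => H x⟩
  tfae_have 3 → 1 := fun h => (hthree I h).2
  tfae_finish
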